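/- **Strong normalization for the system $\mathcal{AF}2S$.** Let $L$ be a language with function symbols and predicate symbols of finite arities, and let $E$ be a set of equations $t=t'$ between terms of $L$. Types are the second-order formulas over $L$, up to renaming of bound variables. They are built from $\bot$ and the atoms $P(t_1,\dots,t_n)$ and $X(t_1,\dots,t_n)$ ($P$ an $n$-ary predicate symbol, $X$ an $n$-ary predicate variable, $n\ge 0$) by $\to$, $\forall x$ (over individual variables) and $\forall X$ (over predicate variables of any arity). Substitutions avoid capture; $A[G/X(x_1,\dots,x_n)]$ is obtained from $A$ by replacing each atom $X(t_1,\dots,t_n)$ by $G[t_1/x_1,\dots,t_n/x_n]$. A *particular case* of an equation $t=t'$ is an equation $t\sigma=t'\sigma$ or $t'\sigma=t\sigma$, where $\sigma$ is a substitution of terms for individual variables. The relation $A\subseteq B$ between formulas is the least relation such that, for every individual or predicate variable $\xi$: - $A\subseteq A$; - $\forall\xi(C\to D)\subseteq \forall\xi C\to\forall\xi D$; - if $C'\subseteq C$ and $D\subseteq D'$, then $C\to D\subseteq C'\to D'$; - if $A\subseteq\forall x C$, then $A\subseteq C[u/x]$ for every term $u$; if $A\subseteq\forall X C$ with $X$ $n$-ary,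 then $A\subseteq C[G/X(x_1,\dots,x_n)]$ for every formula $G$; - if $A\subseteq D$ and $\xi$ is not free in $A$, then $A\subseteq\forall\xi D$; - if $A\subseteq D$ and $D\subseteq B$, then $A\subseteq B$; - if $A\subseteq D[u/y]$ and $u=v$ is a particular case of an equation of $E$, then $A\subseteq D[v/y]$. A context $\Gamma$ is a finite set of declarations $x_i:A_i$ with distinct $\lambda$-variables $x_i$. The judgement $\Gamma\vdash_{\mathcal{AF}2S}t:A$, for a pure $\lambda$-term $t$ (up to renaming of bound variables), is defined by the following three rules, in which $\forall\boldsymbol\xi$ stands for $\forall\xi_1\cdots\forall\xi_k$ ($k\ge 0$), where $\xi_1,\dots,\xi_k$ are individual or predicate variables that are not free in $\Gamma$: - (S1) if $(x:B)\in\Gamma$ and $\forall\boldsymbol\xi B\subseteq A$, then $\Gamma\vdash x:A$; - (S2) if $\Gamma,x:B\vdash u:C$ and $\forall\boldsymbol\xi(B\to C)\subseteq A$, then $\Gamma\vdash\lambda x\,u:A$; - (S3) if $\Gamma\vdash u:B\to C$, $\Gamma\vdash v:B$ and $\forall\boldsymbol\xi C\subseteq A$, then $\Gamma\vdash (u)v:A$.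 **Theorem.** For all $L$, $E$, $\Gamma$, $t$ and $A$: if $\Gamma\vdash_{\mathcal{AF}2S}t:A$, then $t$ is strongly normalizable, i.e. there is no infinite sequence of $\beta$-reduction steps starting with $t$. -/

import Mathlib

/-! Untyped lambda-terms and second-order formulas are represented with de Bruijn indices, so that
syntactic equality is equality up to renaming of bound variables. -/

universe u v

namespace AF2S

/-! ### Pure lambda-calculus -/

/-- Terms of the pure lambda-calculus, with de Bruijn indices. -/
inductive Lam : Type
  | var : ℕ → Lam
  | app : Lam → Lam → Lam
  | lam : Lam → Lam

namespace Lam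

/-- Extend a renaming under one abstraction. -/
def upRen (r : ℕ → ℕ) : ℕ → ℕ
  | 0 => 0
  | i + 1 => r i + 1

/-- Renaming of the free variables. -/
def rename : (ℕ → ℕ) → Lam → Lam
  | r, var i => var (r i)
  | r, app t u => app (rename r t) (rename r u)
  | r, lam t => lam (rename (upRen r) t)

/-- Extend a substitution under one abstraction. -/
def up (s : ℕ → Lam) : ℕ → Lam
  | 0 => var 0
  | i + 1 => (s i).rename Nat.succ

/-- Simultaneous capture-avoiding substitution. -/
def subst : (ℕ → Lam) → Lam → Lam
  | s, var i => s i
  | s, app t u => app (subst s t) (subst s u)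
  | s, lam t => lam (subst (up s) t)

/-- The contractum `t[u/x]` of the redex `(λx t)u`. -/
def inst (t u : Lam) : Lam :=
  t.subst fun i => match i with
    | 0 => u
    | j + 1 => var j

/-- One step of beta-reduction, at any position. -/
inductive Beta : Lam → Lam → Prop
  | redex (t u : Lam) : Beta (app (lam t) u) (t.inst u)
  | appL {t t₁ : Lam} (u : Lam) : Beta t t₁ → Beta (app t u) (app t₁ u)
  | appR (t : Lam) {u u₁ : Lam} : Beta u u₁ → Beta (app t u) (app t u₁)
  | lam {t t₁ : Lam} : Beta t t₁ → Beta (lam t) (lam t₁)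

/-- Strong normalizability: no infinite sequence of beta-reduction steps starts with `t`. -/
def StronglyNormalizable (t : Lam) : Prop :=
  ¬ ∃ f : ℕ → Lam, f 0 = t ∧ ∀ n, Beta (f n) (f (n + 1))

end Lam

/-! ### Second-order formulas over a language `L`

Individual terms are Mathlib's first-order terms `L.Term ℕ` with individual variables indexed by
`ℕ`. For every arity `n` there is a separate supply of `n`-ary predicate variables indexed by `ℕ`.
-/

/-- Second-order formulas built with falsity, implication and the two kinds of universal
quantifiers. `allI` binds the individual variable `0`, and `allP n` binds the `n`-ary predicate
variable `0`. -/
inductive Formula (L : FirstOrder.Language.{u, v}) : Type (max u v)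
  | bot : Formula L
  | rel {n : ℕ} (R : L.Relations n) (ts : Fin n → L.Term ℕ) : Formula L
  | pvar (n X : ℕ) (ts : Fin n → L.Term ℕ) : Formula L
  | imp : Formula L → Formula L → Formula L
  | allI : Formula L → Formula L
  | allP (n : ℕ) : Formula L → Formula L

variable {L : FirstOrder.Language.{u, v}}

/-- Extend an individual substitution under one individual quantifier. -/
def upI (s : ℕ → L.Term ℕ) : ℕ → L.Term ℕ
  | 0 => FirstOrder.Language.Term.var 0
  | i + 1 => (s i).relabel Nat.succ

/-- Extend a renaming of predicate variables under one `n`-ary predicate quantifier. -/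
def upRenP (n : ℕ) (r : ℕ → ℕ → ℕ) (m : ℕ) (X : ℕ) : ℕ :=
  if m = n then
    match X with
    | 0 => 0
    | Y + 1 => r m Y + 1
  else r m X

namespace Formula

/-- Simultaneous capture-avoiding substitution of terms for individual variables. -/
def substI : (ℕ → L.Term ℕ) → Formula L → Formula L
  | _, bot => bot
  | s, rel R ts => rel R fun i => (ts i).subst s
  | s, pvar n X ts => pvar n X fun i => (ts i).subst s
  | s, imp A B => imp (substI s A) (substI s B)
  | s, allI A => allI (substI (upI s) A)
  | s, allP n A => allP n (substI s A)

/-- Renaming of predicate variables: the `n`-ary variable `X` becomes `r n X`. -/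
def renP : (ℕ → ℕ → ℕ) → Formula L → Formula L
  | _, bot => bot
  | _, rel R ts => rel R ts
  | r, pvar n X ts => pvar n (r n X) ts
  | r, imp A B => imp (renP r A) (renP r B)
  | r, allI A => allI (renP r A)
  | r, allP n A => allP n (renP (upRenP n r) A)

/-- Reindex a formula so that the individual variable `0` becomes a fresh one. -/
def shiftI (A : Formula L) : Formula L :=
  A.substI fun i => FirstOrder.Language.Term.var (i + 1)

/-- Reindex a formula so that the `n`-ary predicate variable `0` becomes a fresh one. -/
def shiftP (n : ℕ) (A : Formula L) : Formula L :=
  A.renP fun m X => if m = n then X + 1 else X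

/-- `A[u/x]`, where `x` is the individual variable `0` of `A`, which disappears. -/
def instI (A : Formula L) (u : L.Term ℕ) : Formula L :=
  A.substI fun i => match i with
    | 0 => u
    | j + 1 => FirstOrder.Language.Term.var j

end Formula

/-- A formula abstracted over `n` individual variables is a formula `G` whose individual variables
`0, …, n - 1` are the abstracted variables `x₁, …, xₙ`, and whose individual variable `n + k` is
the ambient variable `k`. `applyArgs G ts` is `G[t₁/x₁, …, tₙ/xₙ]`. -/
def applyArgs {n : ℕ} (G : Formula L) (ts : Fin n → L.Term ℕ) : Formula L :=
  G.substI fun i => if h : i < n then ts ⟨i, h⟩ else FirstOrder.Language.Term.var (i - n)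

/-- A substitution for predicate variables assigns to the `n`-ary variable `X` a formula `θ n X`
abstracted over `n` individual variables. This is its extension under an individual quantifier. -/
def upPI (θ : ℕ → ℕ → Formula L) (n X : ℕ) : Formula L :=
  (θ n X).substI fun i => FirstOrder.Language.Term.var (if i < n then i else i + 1)

/-- The atom `X(x₁, …, xₙ)` abstracted over `x₁, …, xₙ`. -/
def genericAtom (n X : ℕ) : Formula L :=
  Formula.pvar n X fun i => FirstOrder.Language.Term.var i

/-- The extension of a substitution for predicate variables under an `m`-ary predicate
quantifier. -/
def upPP (m : ℕ) (θ : ℕ → ℕ → Formula L) (n X : ℕ) : Formula L :=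
  if n = m then
    match X with
    | 0 => genericAtom n 0
    | Y + 1 => (θ n Y).shiftP m
  else (θ n X).shiftP m

namespace Formula

/-- Simultaneous capture-avoiding substitution for predicate variables: each atom `X(t₁, …, tₙ)`
is replaced by `(θ n X)[t₁/x₁, …, tₙ/xₙ]`. -/
def substP : (ℕ → ℕ → Formula L) → Formula L → Formula L
  | _, bot => bot
  | _, rel R ts => rel R ts
  | θ, pvar n X ts => applyArgs (θ n X) ts
  | θ, imp A B => imp (substP θ A) (substP θ B)
  | θ, allI A => allI (substP (upPI θ) A)
  | θ, allP m A => allP m (substP (upPP m θ) A)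

/-- `A[G/X(x₁, …, xₙ)]`, where `X` is the `n`-ary predicate variable `0` of `A`, which disappears,
and `G` is abstracted over `x₁, …, xₙ`. -/
def instP (n : ℕ) (A G : Formula L) : Formula L :=
  A.substP fun m X =>
    if m = n then
      match X with
      | 0 => G
      | Y + 1 => genericAtom m Y
    else genericAtom m X

end Formula

/-! ### Variables of both kinds -/

/-- The kind of a variable `ξ`: individual, or `n`-ary predicate. -/
inductive Kind : Type
  | ind : Kind
  | pred (n : ℕ) : Kind

namespace Formula

/-- `∀ξ A`, where `ξ` is the variable `0` of the given kind. -/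
def all : Kind → Formula L → Formula L
  | Kind.ind, A => allI A
  | Kind.pred n, A => allP n A

/-- Make the variable `0` of the given kind fresh; this expresses "`ξ` is not free in `A`". -/
def shift : Kind → Formula L → Formula L
  | Kind.ind, A => shiftI A
  | Kind.pred n, A => shiftP n A

/-- `∀ξ₁ … ∀ξₖ A` for a finite (possibly empty) sequence of variables of both kinds. -/
def alls : List Kind → Formula L → Formula L
  | [], A => A
  | k :: ks, A => all k (alls ks A)

/-- The same formula, seen under the binders `∀ξ₁ … ∀ξₖ`: none of `ξ₁, …, ξₖ` is free in it. -/
def shifts : List Kind → Formula L → Formula L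
  | [], A => A
  | k :: ks, A => shifts ks (shift k A)

end Formula

/-! ### The containment relation and the typing system -/

/-- A set of equations between terms of `L`; the pair `(t, t₁)` is the equation `t = t₁`. -/
abbrev Equations (L : FirstOrder.Language.{u, v}) : Type u :=
  Set (L.Term ℕ × L.Term ℕ)

/-- `u = v` is a particular case of an equation of `E`: a substitution instance of an equation of
`E`, or such an instance with its sides exchanged. -/
def ParticularCase (E : Equations L) (a b : L.Term ℕ) : Prop :=
  ∃ e ∈ E, ∃ s : ℕ → L.Term ℕ,
    (a = e.1.subst s ∧ b = e.2.subst s) ∨ (a = e.2.subst s ∧ b = e.1.subst s)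

/-- The containment `A ⊆ B` between formulas, with respect to the equations of `E`. -/
inductive Contained (E : Equations L) : Formula L → Formula L → Prop
  | ax (A : Formula L) : Contained E A A
  | dist (ξ : Kind) (C D : Formula L) :
      Contained E (Formula.all ξ (C.imp D)) ((Formula.all ξ C).imp (Formula.all ξ D))
  | arrow {C C₁ D D₁ : Formula L} :
      Contained E C₁ C → Contained E D D₁ → Contained E (C.imp D) (C₁.imp D₁)
  | elimI {A C : Formula L} (t : L.Term ℕ) :
      Contained E A (Formula.allI C) → Contained E A (C.instI t)
  | elimP {n : ℕ} {A C : Formula L} (G : Formula L) :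
      Contained E A (Formula.allP n C) → Contained E A (Formula.instP n C G)
  | intro {A D : Formula L} (ξ : Kind) :
      Contained E (A.shift ξ) D → Contained E A (Formula.all ξ D)
  | trans {A D B : Formula L} :
      Contained E A D → Contained E D B → Contained E A B
  | eqn {A D : Formula L} {a b : L.Term ℕ} :
      Contained E A (D.instI a) → ParticularCase E a b → Contained E A (D.instI b)

/-- A context: the `i`-th entry is the type of the free lambda-variable with index `i`. -/
abbrev Context (L : FirstOrder.Language.{u, v}) : Type (max u v) :=
  List (Formula L)

/-- The same context, seen under the binders `∀ξ₁ … ∀ξₖ`: none of `ξ₁, …, ξₖ` is free in it. -/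
def Context.shifts (ξs : List Kind) (Γ : Context L) : Context L :=
  List.map (Formula.shifts ξs) Γ

/-- The typing judgement `Γ ⊢ t : A` of the system AF2S, with respect to the equations of `E`.
In each rule `ξs` is a finite sequence of variables that are not free in the context. -/
inductive Typing (E : Equations L) : Context L → Lam → Formula L → Prop
  | s1 {Γ : Context L} {i : ℕ} {B A : Formula L} (ξs : List Kind) :
      Γ[i]? = some B →
      Contained E (Formula.alls ξs (B.shifts ξs)) A →
      Typing E Γ (Lam.var i) A
  | s2 {Γ : Context L} {t : Lam} {B C A : Formula L} (ξs : List Kind) :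
      Typing E (B :: Context.shifts ξs Γ) t C →
      Contained E (Formula.alls ξs (B.imp C)) A →
      Typing E Γ (Lam.lam t) A
  | s3 {Γ : Context L} {t w : Lam} {B C A : Formula L} (ξs : List Kind) :
      Typing E (Context.shifts ξs Γ) t (B.imp C) →
      Typing E (Context.shifts ξs Γ) w B →
      Contained E (Formula.alls ξs C) A →
      Typing E Γ (Lam.app t w) A

end AF2S

/-! The proof is a reducibility argument with Girard's candidates. Each formula denotes a candidate,
a set of strongly normalizing terms; `→` is the function space, and `∀X` is the intersection over
all candidates, whatever the arity of `X`. This impredicative intersection contains every instance,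
because any formula substituted for `X` itself denotes a candidate (`interp_instP`).

Individual terms are erased: atoms do not look at their arguments and `∀x` changes nothing. The
equations of `E` are thus harmless, and each containment rule becomes an inclusion of candidates
(`Contained.interp_subset`). Adequacy (`Typing.subst_mem_interp`) puts every typed term, under any
substitution by realizers of the context, in the candidate of its type. Since variables belong to
every candidate, the identity substitution gives the theorem. -/

namespace AF2S

namespace Lam

/-! ### Substitution calculus -/

/-- Add `u` in front of the substitution `s`. -/
def scons (u : Lam) (s : ℕ → Lam) : ℕ → Lam
  | 0 => u
  | i + 1 => s i

theorem inst_eq_subst_scons (t u : Lam) : t.inst u = t.subst (scons u var) := by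
  unfold inst
  congr 1

theorem upRen_comp (r q : ℕ → ℕ) : upRen r ∘ upRen q = upRen (r ∘ q) := by
  funext i
  cases i <;> rfl

theorem rename_rename (t : Lam) (q r : ℕ → ℕ) :
    (t.rename q).rename r = t.rename (r ∘ q) := by
  induction t generalizing q r with
  | var i => rfl
  | app t u iht ihu => simp [rename, iht, ihu]
  | lam t ih => simp [rename, ih, upRen_comp]

theorem up_comp_upRen (s : ℕ → Lam) (r : ℕ → ℕ) : up s ∘ upRen r = up (s ∘ r) := by
  funext i
  cases i <;> rfl

theorem subst_rename (t : Lam) (r : ℕ → ℕ) (s : ℕ → Lam) :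
    (t.rename r).subst s = t.subst (s ∘ r) := by
  induction t generalizing r s with
  | var i => rfl
  | app t u iht ihu => simp [rename, subst, iht, ihu]
  | lam t ih => simp [rename, subst, ih, up_comp_upRen]

theorem rename_up (s : ℕ → Lam) (r : ℕ → ℕ) :
    (fun i => (up s i).rename (upRen r)) = up fun i => (s i).rename r := by
  funext i
  cases i with
  | zero => rfl
  | succ i => simp only [up, rename_rename]; rfl

theorem rename_subst (t : Lam) (s : ℕ → Lam) (r : ℕ → ℕ) :
    (t.subst s).rename r = t.subst fun i => (s i).rename r := by
  induction t generalizing r s with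
  | var i => rfl
  | app t u iht ihu => simp [rename, subst, iht, ihu]
  | lam t ih => simp [rename, subst, ih, rename_up]

theorem subst_up (s₁ s₂ : ℕ → Lam) :
    (fun i => (up s₁ i).subst (up s₂)) = up fun i => (s₁ i).subst s₂ := by
  funext i
  cases i with
  | zero => rfl
  | succ i => simp only [up, subst_rename, rename_subst]; rfl

theorem subst_subst (t : Lam) (s₁ s₂ : ℕ → Lam) :
    (t.subst s₁).subst s₂ = t.subst fun i => (s₁ i).subst s₂ := by
  induction t generalizing s₁ s₂ with
  | var i => rfl
  | app t u iht ihu => simp [subst, iht, ihu]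
  | lam t ih => simp [subst, ih, subst_up]

theorem up_var : up var = var := by
  funext i
  cases i <;> rfl

theorem subst_var (t : Lam) : t.subst var = t := by
  induction t with
  | var i => rfl
  | app t u iht ihu => simp [subst, iht, ihu]
  | lam t ih => simp [subst, up_var, ih]

/-- In the abstraction case of adequacy, this turns the contractum of a substituted body into one
simultaneous substitution, to which the induction hypothesis applies. -/
theorem inst_subst_up (t u : Lam) (s : ℕ → Lam) :
    (t.subst (up s)).inst u = t.subst (scons u s) := by
  rw [inst_eq_subst_scons, subst_subst]
  congr 1
  funext i
  cases i with
  | zero => rfl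
  | succ i =>
    simp only [up, subst_rename]
    exact subst_var _

theorem subst_inst (t u : Lam) (s : ℕ → Lam) :
    (t.inst u).subst s = (t.subst (up s)).inst (u.subst s) := by
  rw [inst_subst_up, inst_eq_subst_scons, subst_subst]
  congr 1
  funext i
  cases i <;> rfl

theorem Beta.subst {t t₁ : Lam} (h : Beta t t₁) (s : ℕ → Lam) :
    Beta (t.subst s) (t₁.subst s) := by
  induction h generalizing s with
  | redex t u => rw [subst_inst]; exact .redex _ _
  | appL u _ ih => exact .appL _ (ih s)
  | appR t _ ih => exact .appR _ (ih s)
  | lam _ ih => exact .lam (ih _)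

theorem Beta.inst {t t₁ : Lam} (h : Beta t t₁) (u : Lam) : Beta (t.inst u) (t₁.inst u) :=
  h.subst _

/-! ### Strong normalization as accessibility -/

/-- Every reduction starting from the term is finite, in inductive form. -/
def SN (t : Lam) : Prop :=
  Acc (fun a b => Beta b a) t

theorem SN.stronglyNormalizable {t : Lam} (h : SN t) : t.StronglyNormalizable := by
  induction h with
  | intro t _ ih =>
    rintro ⟨f, rfl, hf⟩
    exact ih (f 1) (hf 0) ⟨fun n => f (n + 1), rfl, fun n => hf (n + 1)⟩

/-- An infinite reduction of `t` would be carried by `g` to one of `g t`. -/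
theorem SN.of_map {g : Lam → Lam} (hg : ∀ {a b}, Beta a b → Beta (g a) (g b)) {t : Lam}
    (h : SN (g t)) : SN t := by
  generalize hw : g t = w at h
  induction h generalizing t with
  | intro w _ ih =>
    subst hw
    exact .intro _ fun t₁ h₁ => ih _ (hg h₁) rfl

/-- A term is neutral if it is not an abstraction. -/
def Neutral : Lam → Prop
  | lam _ => False
  | _ => True

end Lam

/-! ### Reducibility candidates -/

/-- Girard's reducibility candidates. -/
structure Candidate where
  carrier : Set Lam
  sn : ∀ t ∈ carrier, t.SN
  closed : ∀ t ∈ carrier, ∀ t₁, Lam.Beta t t₁ → t₁ ∈ carrier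
  neutral : ∀ t : Lam, t.Neutral → (∀ t₁, Lam.Beta t t₁ → t₁ ∈ carrier) → t ∈ carrier

namespace Candidate

instance : Membership Lam Candidate :=
  ⟨fun S t => t ∈ S.carrier⟩

theorem var_mem (S : Candidate) (i : ℕ) : Lam.var i ∈ S :=
  S.neutral _ trivial fun _ h => nomatch h

/-- The candidate of all strongly normalizing terms. -/
def top : Candidate where
  carrier := {t | t.SN}
  sn _ h := h
  closed _ h _ h₁ := Acc.inv h h₁
  neutral _ _ h := .intro _ h

/-- The intersection of a family of candidates. -/
def inter (F : Candidate → Candidate) : Candidate where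
  carrier := {t | ∀ S, t ∈ F S}
  -- One member of the family is enough; `top` witnesses that candidates exist.
  sn t h := (F top).sn t (h top)
  closed t h t₁ h₁ S := (F S).closed t (h S) t₁ h₁
  neutral t ht h S := (F S).neutral t ht fun t₁ h₁ => h t₁ h₁ S

/-- The function space of two candidates. -/
def arrow (S T : Candidate) : Candidate where
  carrier := {t | ∀ u ∈ S, t.app u ∈ T}
  -- Variables lie in `S`, so `t` applied to one is in `T`, hence strongly normalizing.
  sn t h := Lam.SN.of_map (g := fun a => a.app (.var 0)) (.appL _) (T.sn _ (h _ (S.var_mem 0)))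
  closed t h t₁ h₁ u hu := T.closed _ (h u hu) _ (.appL u h₁)
  neutral t ht h u hu := by
    have hsn := S.sn u hu
    induction hsn with
    | intro u _ ih =>
      refine T.neutral _ trivial fun w hw => ?_
      cases hw with
      -- A head redex would make `t` an abstraction, against neutrality.
      | redex => exact ht.elim
      | appL _ h₁ => exact h _ h₁ u hu
      | appR _ h₁ => exact ih _ h₁ (S.closed u hu _ h₁)

/-- The redex is neutral, so its one-step reducts suffice: the contractum is in `T` by `h`, and
reductions inside `t` or `u` are handled by nested induction on their strong normalization. -/
theorem app_lam_mem {S T : Candidate} {t u : Lam} (ht : t.SN) (hu : u.SN) (huS : u ∈ S)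
    (h : ∀ w ∈ S, t.inst w ∈ T) : (t.lam).app u ∈ T := by
  induction ht generalizing u with
  | intro t _ iht =>
    induction hu with
    | intro u hu ihu =>
      refine T.neutral _ trivial fun w hw => ?_
      cases hw with
      | redex => exact h u huS
      | appL _ h₁ =>
        cases h₁ with
        | lam h₁ =>
          exact iht _ h₁ (.intro u hu) huS fun w hw => T.closed _ (h w hw) _ (h₁.inst w)
      | appR _ h₁ => exact ihu _ h₁ (S.closed u huS _ h₁)

theorem lam_mem_arrow {S T : Candidate} {t : Lam} (h : ∀ w ∈ S, t.inst w ∈ T) :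
    t.lam ∈ S.arrow T := fun u hu =>
  app_lam_mem (Lam.SN.of_map (g := fun a => a.inst (.var 0)) (fun h₁ => h₁.inst _)
    (T.sn _ (h _ (S.var_mem 0)))) (S.sn u hu) hu h

end Candidate

/-! ### Interpretation of formulas

Individual terms play no role in the interpretation, so equations are satisfied trivially. -/

variable {L : FirstOrder.Language.{u, v}}

/-- A valuation of predicate variables by candidates. -/
abbrev Valuation : Type :=
  ℕ → ℕ → Candidate

/-- Extend a valuation under one `n`-ary predicate quantifier. -/
def Valuation.cons (n : ℕ) (S : Candidate) (I : Valuation) (m X : ℕ) : Candidate :=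
  if m = n then
    match X with
    | 0 => S
    | Y + 1 => I m Y
  else I m X

namespace Formula

/-- The candidate interpreting a formula. -/
def interp : Formula L → Valuation → Candidate
  | bot, _ => .top
  | rel _ _, _ => .top
  | pvar n X _, I => I n X
  | imp A B, I => (interp A I).arrow (interp B I)
  | allI A, I => interp A I
  | allP n A, I => .inter fun S => interp A (I.cons n S)

theorem interp_substI (A : Formula L) (s : ℕ → L.Term ℕ) (I : Valuation) :
    (A.substI s).interp I = A.interp I := by
  induction A generalizing s I with
  | bot => rfl
  | rel R ts => rfl
  | pvar n X ts => rfl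
  | imp A B ihA ihB => simp [substI, interp, ihA, ihB]
  | allI A ih => simp [substI, interp, ih]
  | allP n A ih => simp [substI, interp, ih]

theorem cons_upRenP (n : ℕ) (r : ℕ → ℕ → ℕ) (S : Candidate) (I : Valuation) :
    (fun m X => I.cons n S m (upRenP n r m X)) = Valuation.cons n S fun m X => I m (r m X) := by
  funext m X
  by_cases h : m = n
  · cases X <;> simp [Valuation.cons, upRenP, h]
  · simp [Valuation.cons, upRenP, h]

theorem interp_renP (A : Formula L) (r : ℕ → ℕ → ℕ) (I : Valuation) :
    (A.renP r).interp I = A.interp fun m X => I m (r m X) := by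
  induction A generalizing r I with
  | bot => rfl
  | rel R ts => rfl
  | pvar n X ts => rfl
  | imp A B ihA ihB => simp [renP, interp, ihA, ihB]
  | allI A ih => simp [renP, interp, ih]
  | allP n A ih => simp [renP, interp, ih, cons_upRenP]

theorem interp_shiftP (n : ℕ) (A : Formula L) (S : Candidate) (I : Valuation) :
    (A.shiftP n).interp (I.cons n S) = A.interp I := by
  rw [shiftP, interp_renP]
  congr 1
  funext m X
  by_cases h : m = n <;> simp [Valuation.cons, h]

theorem interp_upPP (m : ℕ) (θ : ℕ → ℕ → Formula L) (S : Candidate) (I : Valuation) :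
    (fun n X => (upPP m θ n X).interp (I.cons m S)) =
      Valuation.cons m S fun n X => (θ n X).interp I := by
  funext n X
  by_cases h : n = m
  · subst h
    cases X <;> simp [Valuation.cons, upPP, interp_shiftP, genericAtom, interp]
  · simp [Valuation.cons, upPP, h, interp_shiftP]

theorem interp_substP (A : Formula L) (θ : ℕ → ℕ → Formula L) (I : Valuation) :
    (A.substP θ).interp I = A.interp fun n X => (θ n X).interp I := by
  induction A generalizing θ I with
  | bot => rfl
  | rel R ts => rfl
  | pvar n X ts => simp [substP, applyArgs, interp_substI, interp]
  | imp A B ihA ihB => simp [substP, interp, ihA, ihB]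
  | allI A ih => simp [substP, interp, ih, upPI, interp_substI]
  | allP n A ih => simp [substP, interp, ih, interp_upPP]

theorem interp_instP (n : ℕ) (A G : Formula L) (I : Valuation) :
    (instP n A G).interp I = A.interp (I.cons n (G.interp I)) := by
  rw [instP, interp_substP]
  congr 1
  funext m X
  by_cases h : m = n
  · cases X <;> simp [Valuation.cons, h, genericAtom, interp]
  · simp [Valuation.cons, h, genericAtom, interp]

/-- `J` stands for `I` extended by arbitrary candidates for the predicate variables among `ξs`. All
that is kept of it is that formulas without the variables `ξs` keep their meaning, which transports
the hypotheses on the context. -/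
theorem mem_interp_alls {ξs : List Kind} {C : Formula L} {I : Valuation} {t : Lam}
    (h : ∀ J : Valuation, (∀ B : Formula L, (B.shifts ξs).interp J = B.interp I) →
      t ∈ C.interp J) :
    t ∈ (alls ξs C).interp I := by
  induction ξs generalizing I with
  | nil => exact h I fun _ => rfl
  | cons ξ ξs ih =>
    cases ξ with
    | ind =>
      exact ih fun J hJ => h J fun B => (hJ _).trans (interp_substI B _ I)
    | pred n =>
      intro S
      exact ih fun J hJ => h J fun B => (hJ _).trans (interp_shiftP n B S I)

end Formula

open Formula

theorem Contained.interp_subset {E : Equations L} {A B : Formula L} (h : Contained E A B)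
    (I : Valuation) {t : Lam} (ht : t ∈ A.interp I) : t ∈ B.interp I := by
  induction h generalizing I t with
  | ax A => exact ht
  | dist ξ C D =>
    cases ξ with
    | ind => exact ht
    | pred n => exact fun u hu S => ht S u (hu S)
  -- Contravariant on the left, covariant on the right.
  | arrow _ _ ihC ihD => exact fun u hu => ihD I (ht u (ihC I hu))
  | elimI a _ ih => rw [instI, interp_substI]; exact ih I ht
  | elimP G _ ih => rw [interp_instP]; exact ih I ht _
  | @intro A D ξ _ ih =>
    cases ξ with
    | ind => exact ih I ((interp_substI A _ I).symm ▸ ht)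
    -- Since `ξ` is not free in `A`, giving it the value `S` leaves the candidate of `A` unchanged.
    | pred n => exact fun S => ih _ ((interp_shiftP n A S I).symm ▸ ht)
  | trans _ _ ih₁ ih₂ => exact ih₂ I (ih₁ I ht)
  -- Both instances of `D` denote the same candidate.
  | eqn _ _ ih =>
    have := ih I ht
    rw [instI, interp_substI] at this ⊢
    exact this

theorem mem_interp_shifts {ξs : List Kind} {Γ : Context L} {I J : Valuation} {s : ℕ → Lam}
    (hs : ∀ i B, Γ[i]? = some B → s i ∈ B.interp I)
    (hJ : ∀ B : Formula L, (B.shifts ξs).interp J = B.interp I) (i : ℕ) (B : Formula L)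
    (hB : (Context.shifts ξs Γ)[i]? = some B) : s i ∈ B.interp J := by
  simp only [Context.shifts, List.getElem?_map, Option.map_eq_some_iff] at hB
  obtain ⟨C, hC, rfl⟩ := hB
  exact (hJ C).symm ▸ hs i C hC

/-- Adequacy of the interpretation. -/
theorem Typing.subst_mem_interp {E : Equations L} {Γ : Context L} {t : Lam} {A : Formula L}
    (h : Typing E Γ t A) (I : Valuation) (s : ℕ → Lam)
    (hs : ∀ i B, Γ[i]? = some B → s i ∈ B.interp I) : t.subst s ∈ A.interp I := by
  induction h generalizing I s with
  | s1 ξs hB hA =>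
    exact hA.interp_subset I (mem_interp_alls fun J hJ => (hJ _).symm ▸ hs _ _ hB)
  | s2 ξs _ hA ih =>
    refine hA.interp_subset I (mem_interp_alls fun J hJ => Candidate.lam_mem_arrow fun w hw => ?_)
    rw [Lam.inst_subst_up]
    refine ih J _ fun i B hB => ?_
    cases i with
    | zero => cases hB; exact hw
    | succ i => exact mem_interp_shifts hs hJ i B hB
  | s3 ξs _ _ hA iht ihw =>
    exact hA.interp_subset I (mem_interp_alls fun J hJ =>
      iht J s (mem_interp_shifts hs hJ) _ (ihw J s (mem_interp_shifts hs hJ)))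

end AF2S

theorem theorem28 {L : FirstOrder.Language.{u, v}} (E : AF2S.Equations L)
    (Γ : AF2S.Context L) (t : AF2S.Lam) (A : AF2S.Formula L)
    (h : AF2S.Typing E Γ t A) : t.StronglyNormalizable := by
  -- Any valuation would do here.
  have ht := h.subst_mem_interp (fun _ _ => .top) AF2S.Lam.var fun i B _ =>
    AF2S.Candidate.var_mem _ i
  rw [AF2S.Lam.subst_var] at ht
  exact (AF2S.Candidate.sn _ _ ht).stronglyNormalizable
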